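/- **Setting.** Let $K$ be a commutative semiring containing $\mathbb N$ (for instance $\mathbb N$ or $\mathbb Z$), and let $\mathcal R=K[Y,X_1,X_2,\dots]$. For a finite multigraph $G=(V,E)$ with $V\neq\emptyset$ and $A\subseteq E$ let $k(A)$ be the number of connected components of the spanning subgraph $(V,A)$, $r(A)=|V|-k(A)$, and $s(i,A)$ the number of connected components of $(V,A)$ with exactly $i$ vertices. The Noble–Welsh polynomial is $$U(G,\bar X,Y)=\sum_{A\subseteq E}Y^{|A|-r(A)}\prod_{i=1}^{|V|}X_i^{s(i,A)}\in\mathcal R .$$ Graphs are presented as structures with one binary relation $R$ in one of two ways: (1) a finite simple graph has universe $V$, and $R$ is adjacency; (2) a finite multigraph has universe $V\sqcup E$, and $R\subseteq V\times E$ is incidence. **SOL-polynomials.** Fix a vocabulary of relation symbols and constants, and second order logic (SOL) over it, with quantification over individual variables and over relation variables of every arity $\ge 1$. *SOL-monomial expressions* are built from elements of $\mathcal R$ and truth values $\mathrm{tv}(\varphi)\in\{0,1\}$ of SOL-formulas by finite products and by products $\prod_{\bar a:\varphi}t$ over the tuples of individuals $\bar a$ that satisfy an SOL-formula $\varphi$.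 *SOL-polynomial expressions* are built from SOL-monomial expressions by finite sums, by short sums $\sum_{\bar a:\varphi}t$ over tuples of individuals, and by long sums $\sum_{\bar W:\varphi}t$ over tuples of relations; they are *short* if no long sum occurs. A graph polynomial $P$ is *SOL-definable* if there is one SOL-polynomial expression $S$ over the vocabulary $\{R\}$ such that, for every graph $G$ and every assignment $z$ of the variables, $P(G)$ is the value of $S$ in $G$ under $z$. **Feasible recursive definitions.** Let $m\in\mathbb N$. A *context structure* $\bar G=\langle A,R,\vec x,O\rangle$ is a finite non-empty set $A$ with a binary relation $R$, a tuple $\vec x\in A^m$ and a binary relation $O$ on $A^m$; formulas about it use symbols for $R$, $x_1,\dots,x_m$ and $O$. For an SOL-sentence $\varphi_{ord}$ let $\mathrm{VALORD}$ be the class of the $\bar G\models\varphi_{ord}$ in which $O$ is a linear order of $A^m$ with first element $\vec x$. A *guarded scheme* $(T,\varphi)$ consists of an SOL-sentence $\varphi$ (the guard) and SOL-formulas $\phi(u),\psi(u,v)$; if $A'=\{a:\bar G\models\phi(a)\}$ is non-empty, $T^\star(\bar G)$ has universe $A'$, relation $\{(a,b)\in A'^2:\bar G\models\psi(a,b)\}$,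 the restriction of $O$ to $A'^m$ as order, and the first tuple in that order as context; otherwise $T^\star(\bar G)=\emptyset$. The scheme is *enabled* on $\bar G$ if $\bar G\models\varphi$. It is a *deconstruction* along $\mathrm{VALORD}$ if for every $\bar G\in\mathrm{VALORD}$ on which it is enabled, some $x_i$ is not in $A'$, and $T^\star(\bar G)$ is empty or in $\mathrm{VALORD}$. A *recursive definition* consists of $m$, $\varphi_{ord}$, finitely many guarded deconstructions $(T_i,\varphi_i)$ along $\mathrm{VALORD}$, and for each $i$ a short SOL-polynomial expression $\sigma_i$ without free variables. A *deconstruction tree* of $\bar G$ is a tree with root marked $\bar G$ in which a node marked by a non-empty $\bar H$ has exactly one child, marked $T_i^\star(\bar H)$, for each enabled $i$, and in which all leaves are marked by the empty structure. It is evaluated by $$P(\bar H)=\sum_{i:\ \bar H\models\varphi_i}\sigma_i(\bar H)\cdot P(T_i^\star(\bar H)),\qquad P(\emptyset)=1 .$$ The definition is *SOL-feasible* for a class of graphs if every graph $G$ of the class has an expansion $\langle G,\vec x,O\rangle\in\mathrm{VALORD}$, every such expansion has a deconstruction tree, and the value at the root is the same for all such expansions of $G$. It defines $P$ if this value is always $P(G)$.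 **Statement.** For each of the two presentations (1) and (2): (i) $U(G,\bar X,Y)$ is not an SOL-definable polynomial. (ii) $U(G,\bar X,Y)$ has no SOL-feasible recursive definition. -/

import Mathlib

noncomputable section

namespace SOL

/-! ### Second order logic -/

/-- Variables of second order logic. `ind i` is the individual variable `v_i`; `rel r i` is a
relation variable of arity `r + 1` (so that all arities are at least one). -/
inductive Var : Type
  | ind (i : ℕ) : Var
  | rel (r i : ℕ) : Var

/-- An `A`-interpretation of the variables. -/
structure Assignment (A : Type) where
  ind : ℕ → A
  rel : (r : ℕ) → ℕ → Set (Fin (r + 1) → A)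

namespace Assignment

variable {A : Type}

/-- Change the value of the individual variable `v_j` to `a`. -/
def setInd (z : Assignment A) (j : ℕ) (a : A) : Assignment A :=
  { z with ind := Function.update z.ind j a }

/-- Change the value of the `j`-th relation variable of arity `r + 1` to `S`. -/
def setRel (z : Assignment A) (r j : ℕ) (S : Set (Fin (r + 1) → A)) : Assignment A :=
  { z with rel := Function.update z.rel r (Function.update (z.rel r) j S) }

/-- `z₁` agrees with `z` except possibly on the individual variables `v_i`, `i ∈ vs`. -/
def AgreeOffInd (vs : Finset ℕ) (z z₁ : Assignment A) : Prop :=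
  (∀ i, i ∉ vs → z₁.ind i = z.ind i) ∧ z₁.rel = z.rel

/-- `z₁` agrees with `z` except possibly on the relation variables `rel r i`, `(r, i) ∈ Ws`. -/
def AgreeOffRel (Ws : Finset (ℕ × ℕ)) (z z₁ : Assignment A) : Prop :=
  z₁.ind = z.ind ∧ ∀ r i, (r, i) ∉ Ws → z₁.rel r i = z.rel r i

/-- Over a finite universe, only finitely many assignments agree with `z` off a finite set of
individual variables; so the sums and products below are finite. -/
theorem finite_agreeOffInd [Finite A] (vs : Finset ℕ) (z : Assignment A) :
    {z₁ | AgreeOffInd vs z z₁}.Finite := by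
  refine Set.Finite.of_injOn (f := fun z₁ : Assignment A => fun i : vs => z₁.ind i)
    (t := Set.univ) (fun _ _ => Set.mem_univ _) ?_ Set.finite_univ
  rintro ⟨i₁, r₁⟩ ⟨h₁, h₁'⟩ ⟨i₂, r₂⟩ ⟨h₂, h₂'⟩ h
  simp only at h h₁ h₂ h₁' h₂'
  subst h₁' h₂'
  congr 1
  funext i
  by_cases hi : i ∈ vs
  · exact congrFun h ⟨i, hi⟩
  · rw [h₁ i hi, h₂ i hi]

/-- The same for relation variables. -/
theorem finite_agreeOffRel [Finite A] (Ws : Finset (ℕ × ℕ)) (z : Assignment A) :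
    {z₁ | AgreeOffRel Ws z z₁}.Finite := by
  refine Set.Finite.of_injOn
    (f := fun z₁ : Assignment A => fun w : Ws => z₁.rel w.1.1 w.1.2)
    (t := Set.univ) (fun _ _ => Set.mem_univ _) ?_ Set.finite_univ
  rintro ⟨i₁, r₁⟩ ⟨h₁, h₁'⟩ ⟨i₂, r₂⟩ ⟨h₂, h₂'⟩ h
  simp only at h h₁ h₂ h₁' h₂'
  subst h₁ h₂
  congr 1
  funext r i
  by_cases hi : (r, i) ∈ Ws
  · exact congrFun h ⟨(r, i), hi⟩
  · rw [h₁' r i hi, h₂' r i hi]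

end Assignment

/-- Terms over a vocabulary (only its constants and relation symbols are used): individual
variables and constants. -/
inductive Term (τ : FirstOrder.Language.{0, 0}) : Type
  | var (i : ℕ) : Term τ
  | const (c : τ.Constants) : Term τ

namespace Term

variable {τ : FirstOrder.Language.{0, 0}} {A : Type}

def free : Term τ → Set Var
  | var i => {Var.ind i}
  | const _ => ∅

def value (M : τ.Structure A) (z : Assignment A) : Term τ → A
  | var i => z.ind i
  | const c => M.funMap c Fin.elim0

end Term

/-- Formulas of second order logic over the vocabulary `τ`. -/
inductive Formula (τ : FirstOrder.Language.{0, 0}) : Type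
  | eq (t₁ t₂ : Term τ) : Formula τ
  | relVar (r j : ℕ) (t : Fin (r + 1) → Term τ) : Formula τ
  | rel {n : ℕ} (R : τ.Relations n) (t : Fin n → Term τ) : Formula τ
  | or (φ ψ : Formula τ) : Formula τ
  | and (φ ψ : Formula τ) : Formula τ
  | imp (φ ψ : Formula τ) : Formula τ
  | not (φ : Formula τ) : Formula τ
  | ex (j : ℕ) (φ : Formula τ) : Formula τ
  | all (j : ℕ) (φ : Formula τ) : Formula τ
  | exRel (r j : ℕ) (φ : Formula τ) : Formula τ
  | allRel (r j : ℕ) (φ : Formula τ) : Formula τ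

namespace Formula

variable {τ : FirstOrder.Language.{0, 0}} {A : Type}

/-- Free variables of a formula. -/
def free : Formula τ → Set Var
  | eq t₁ t₂ => t₁.free ∪ t₂.free
  | relVar r j t => {Var.rel r j} ∪ ⋃ i, (t i).free
  | rel _ t => ⋃ i, (t i).free
  | or φ ψ => φ.free ∪ ψ.free
  | and φ ψ => φ.free ∪ ψ.free
  | imp φ ψ => φ.free ∪ ψ.free
  | not φ => φ.free
  | ex j φ => φ.free \ {Var.ind j}
  | all j φ => φ.free \ {Var.ind j}
  | exRel r j φ => φ.free \ {Var.rel r j}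
  | allRel r j φ => φ.free \ {Var.rel r j}

/-- Satisfaction `M, z ⊨ φ`. -/
def Sat (M : τ.Structure A) : Assignment A → Formula τ → Prop
  | z, eq t₁ t₂ => t₁.value M z = t₂.value M z
  | z, relVar r j t => (fun i => (t i).value M z) ∈ z.rel r j
  | z, rel R t => M.RelMap R (fun i => (t i).value M z)
  | z, or φ ψ => Sat M z φ ∨ Sat M z ψ
  | z, and φ ψ => Sat M z φ ∧ Sat M z ψ
  | z, imp φ ψ => Sat M z φ → Sat M z ψ
  | z, not φ => ¬ Sat M z φ
  | z, ex j φ => ∃ a : A, Sat M (z.setInd j a) φ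
  | z, all j φ => ∀ a : A, Sat M (z.setInd j a) φ
  | z, exRel r j φ => ∃ S, Sat M (z.setRel r j S) φ
  | z, allRel r j φ => ∀ S, Sat M (z.setRel r j S) φ

end Formula

/-! ### SOL-polynomial expressions -/

/-- SOL-monomial expressions with values in `𝓡`. In `bprod vs φ t` the product operator binds the
individual variables `v_i`, `i ∈ vs`. -/
inductive MonoExpr (τ : FirstOrder.Language.{0, 0}) (𝓡 : Type*) : Type _
  | const (a : 𝓡) : MonoExpr τ 𝓡
  | tv (φ : Formula τ) : MonoExpr τ 𝓡
  | prod {r : ℕ} (t : Fin r → MonoExpr τ 𝓡) : MonoExpr τ 𝓡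
  | bprod (vs : Finset ℕ) (φ : Formula τ) (t : MonoExpr τ 𝓡) : MonoExpr τ 𝓡

/-- SOL-polynomial expressions with values in `𝓡`: `bsum` is a short sum (over individual
variables), `bsumRel` a long sum (over relation variables). -/
inductive PolyExpr (τ : FirstOrder.Language.{0, 0}) (𝓡 : Type*) : Type _
  | mono (t : MonoExpr τ 𝓡) : PolyExpr τ 𝓡
  | sum {r : ℕ} (t : Fin r → PolyExpr τ 𝓡) : PolyExpr τ 𝓡
  | bsum (vs : Finset ℕ) (φ : Formula τ) (t : PolyExpr τ 𝓡) : PolyExpr τ 𝓡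
  | bsumRel (Ws : Finset (ℕ × ℕ)) (φ : Formula τ) (t : PolyExpr τ 𝓡) : PolyExpr τ 𝓡

namespace MonoExpr

variable {τ : FirstOrder.Language.{0, 0}} {𝓡 : Type*} {A : Type}

def free : MonoExpr τ 𝓡 → Set Var
  | const _ => ∅
  | tv φ => φ.free
  | prod t => ⋃ i, (t i).free
  | bprod vs φ t => (t.free ∪ φ.free) \ {v | ∃ i ∈ vs, v = Var.ind i}

open Classical in
/-- The interpretation `e(t, M, z)` of a monomial expression. -/
def eval [CommSemiring 𝓡] (M : τ.Structure A) : MonoExpr τ 𝓡 → Assignment A → 𝓡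
  | const a, _ => a
  | tv φ, z => if φ.Sat M z then 1 else 0
  | prod t, z => ∏ i, (t i).eval M z
  | bprod vs φ t, z => ∏ᶠ z₁ ∈ {z₁ | z.AgreeOffInd vs z₁ ∧ φ.Sat M z₁}, t.eval M z₁

end MonoExpr

namespace PolyExpr

variable {τ : FirstOrder.Language.{0, 0}} {𝓡 : Type*} {A : Type}

def free : PolyExpr τ 𝓡 → Set Var
  | mono t => t.free
  | sum t => ⋃ i, (t i).free
  | bsum vs φ t => (t.free ∪ φ.free) \ {v | ∃ i ∈ vs, v = Var.ind i}
  | bsumRel Ws φ t => (t.free ∪ φ.free) \ {v | ∃ w ∈ Ws, v = Var.rel w.1 w.2}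

/-- The interpretation `e(S, M, z)` of a polynomial expression. -/
def eval [CommSemiring 𝓡] (M : τ.Structure A) : PolyExpr τ 𝓡 → Assignment A → 𝓡
  | mono t, z => t.eval M z
  | sum t, z => ∑ i, (t i).eval M z
  | bsum vs φ t, z => ∑ᶠ z₁ ∈ {z₁ | z.AgreeOffInd vs z₁ ∧ φ.Sat M z₁}, t.eval M z₁
  | bsumRel Ws φ t, z => ∑ᶠ z₁ ∈ {z₁ | z.AgreeOffRel Ws z₁ ∧ φ.Sat M z₁}, t.eval M z₁

/-- An expression is short if it contains no long sum. -/
def IsShort : PolyExpr τ 𝓡 → Prop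
  | mono _ => True
  | sum t => ∀ i, (t i).IsShort
  | bsum _ _ t => t.IsShort
  | bsumRel _ _ _ => False

end PolyExpr

/-! ### Structures for graphs -/

/-- A finite nonempty set with one binary relation. -/
structure BinStr : Type 1 where
  carrier : Type
  [finite : Finite carrier]
  [nonempty : Nonempty carrier]
  R : carrier → carrier → Prop

attribute [instance] BinStr.finite BinStr.nonempty

/-- A `BinStr` as a structure for the vocabulary with a single binary relation symbol. -/
@[reducible] def BinStr.toStructure (M : BinStr) : FirstOrder.Language.graph.Structure M.carrier where
  funMap := fun f => nomatch f
  RelMap := fun {_} r => match r with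
    | .adj => fun xs => M.R (xs 0) (xs 1)

/-- Let `str` present the members of a class `𝒢` of graphs as structures with one binary relation.
The graph polynomial `P` is SOL-definable if it is the interpretation of one SOL-polynomial
expression on all graphs of the class (for every assignment). -/
def IsSOLPolynomial {𝒢 : Type*} (str : 𝒢 → BinStr) {𝓡 : Type*} [CommSemiring 𝓡]
    (P : 𝒢 → 𝓡) : Prop :=
  ∃ S : PolyExpr FirstOrder.Language.graph 𝓡, ∀ (G : 𝒢) (z : Assignment (str G).carrier),
    P G = S.eval (str G).toStructure z

/-! ### Ordered graphs with a context -/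

/-- Relation symbols of the vocabulary with a binary symbol and a `2m`-ary symbol. -/
inductive OrdRel (m : ℕ) : ℕ → Type
  | edge : OrdRel m 2
  | ord : OrdRel m (m + m)

/-- The constant symbols `a_1, …, a_m`. -/
inductive CtxConst (m : ℕ) : ℕ → Type
  | ctx (i : Fin m) : CtxConst m 0

/-- The vocabulary `{R, a_1, …, a_m, O}` with `R` binary and `O` of arity `2m`. -/
def ordLang (m : ℕ) : FirstOrder.Language.{0, 0} := ⟨CtxConst m, OrdRel m⟩

/-- A structure `⟨A, R, x, O⟩` with an `m`-context `x` and a binary relation `O` on `m`-tuples. -/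
structure CtxStr (m : ℕ) : Type 1 extends BinStr where
  ctx : Fin m → carrier
  O : (Fin m → carrier) → (Fin m → carrier) → Prop

namespace CtxStr

variable {m : ℕ}

@[reducible] def toOrdStructure (G : CtxStr m) : (ordLang m).Structure G.carrier where
  funMap := fun {_} f => match f with
    | .ctx i => fun _ => G.ctx i
  RelMap := fun {_} r => match r with
    | .edge => fun xs => G.R (xs 0) (xs 1)
    | .ord => fun xs => G.O (fun i => xs (Fin.castAdd m i)) (fun i => xs (Fin.natAdd m i))

/-- An assignment used to evaluate expressions without free variables. -/
def someAssignment (G : CtxStr m) : Assignment G.carrier :=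
  ⟨fun _ => Classical.arbitrary _, fun _ _ => ∅⟩

/-- Truth of a sentence. -/
def Models (G : CtxStr m) (φ : Formula (ordLang m)) : Prop :=
  φ.Sat G.toOrdStructure G.someAssignment

/-- Truth of `φ(a)`, where `v_0` is the only free variable of `φ`. -/
def Models₁ (G : CtxStr m) (φ : Formula (ordLang m)) (a : G.carrier) : Prop :=
  φ.Sat G.toOrdStructure (G.someAssignment.setInd 0 a)

/-- Truth of `φ(a, b)`, where `v_0`, `v_1` are the only free variables of `φ`. -/
def Models₂ (G : CtxStr m) (φ : Formula (ordLang m)) (a b : G.carrier) : Prop :=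
  φ.Sat G.toOrdStructure ((G.someAssignment.setInd 0 a).setInd 1 b)

/-- `O` is a (reflexive) linear ordering of the `m`-tuples and the context is its first element. -/
def IsOrdered (G : CtxStr m) : Prop :=
  (∀ x, G.O x x) ∧ (∀ x y, G.O x y → G.O y x → x = y) ∧
  (∀ x y w, G.O x y → G.O y w → G.O x w) ∧ (∀ x y, G.O x y ∨ G.O y x) ∧
  ∀ y, G.O G.ctx y

end CtxStr

/-- The class `VALORD` defined by the sentence `φord`. -/
def VALORD {m : ℕ} (φord : Formula (ordLang m)) : Set (CtxStr m) :=
  {G | G.IsOrdered ∧ G.Models φord}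

/-- The structure `⟨M, x, O⟩`. -/
def BinStr.expand (M : BinStr) {m : ℕ} (x : Fin m → M.carrier)
    (O : (Fin m → M.carrier) → (Fin m → M.carrier) → Prop) : CtxStr m :=
  { M with ctx := x, O := O }

/-! ### Deconstruction schemes, deconstruction trees and recursive definitions -/

/-- A translation scheme `⟨dom, edge⟩` together with a guard. The formula `dom(v_0)` defines the
new universe and `edge(v_0, v_1)` the new binary relation; all formulas may use the context through
the constants `a_i`, and the order `O`. -/
structure GuardedScheme (m : ℕ) where
  dom : Formula (ordLang m)
  edge : Formula (ordLang m)
  guard : Formula (ordLang m)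
  dom_free : dom.free ⊆ {Var.ind 0}
  edge_free : edge.free ⊆ {Var.ind 0, Var.ind 1}
  guard_free : guard.free = ∅

namespace GuardedScheme

variable {m : ℕ}

/-- The guarded scheme is enabled on `G`. -/
def Enabled (T : GuardedScheme m) (G : CtxStr m) : Prop := G.Models T.guard

/-- The universe of the transduced structure; it may be empty. -/
def Universe (T : GuardedScheme m) (G : CtxStr m) : Type := {a : G.carrier // G.Models₁ T.dom a}

/-- The order of the transduced structure is the restriction of the order of `G`. -/
def restrictO (T : GuardedScheme m) (G : CtxStr m) (x y : Fin m → T.Universe G) : Prop :=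
  G.O (fun i => (x i).1) (fun i => (y i).1)

/-- The transduced structure, when its universe is nonempty. Its context is the first remaining
`m`-tuple in the restricted order. -/
def transduce (T : GuardedScheme m) (G : CtxStr m) (h : Nonempty (T.Universe G)) : CtxStr m where
  carrier := T.Universe G
  finite := inferInstanceAs (Finite {a : G.carrier // G.Models₁ T.dom a})
  nonempty := h
  R := fun a b => G.Models₂ T.edge a.1 b.1
  ctx := haveI := h; Classical.epsilon fun x => ∀ y, T.restrictO G x y
  O := T.restrictO G

/-- `T` is a guarded deconstruction along `VALORD φord`: on every structure of the class on which
`T` is enabled, at least one element of the context is deleted (so the universe gets strictly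
smaller), and the resulting structure is empty or again belongs to the class. -/
def IsDeconstruction (T : GuardedScheme m) (φord : Formula (ordLang m)) : Prop :=
  ∀ G ∈ VALORD φord, T.Enabled G →
    (∃ i, ¬ G.Models₁ T.dom (G.ctx i)) ∧
    ∀ h : Nonempty (T.Universe G), T.transduce G h ∈ VALORD φord

end GuardedScheme

/-- Deconstruction trees for the schemes `T 0, …, T (ℓ-1)` with root marked by `G`. A node marked by
a (nonempty) structure has one child for every enabled scheme, and there is at least one such scheme,
so that all leaves are marked by the empty structure. The empty children are not recorded. -/
inductive DTree {m ℓ : ℕ} (T : Fin ℓ → GuardedScheme m) : CtxStr m → Type 1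
  | node (G : CtxStr m) (enabled : ∃ i, (T i).Enabled G)
      (child : ∀ i, (T i).Enabled G → ∀ h : Nonempty ((T i).Universe G),
        DTree T ((T i).transduce G h)) : DTree T G

/-- A recursive definition of a graph polynomial: a finite family of guarded schemes acting on the
class `VALORD` of `φord`, and for each of them a coefficient given by a short SOL-polynomial
expression over the vocabulary of the ordered graphs with a context. -/
structure RecDef (m : ℕ) (𝓡 : Type*) where
  φord : Formula (ordLang m)
  φord_free : φord.free = ∅
  ℓ : ℕ
  T : Fin ℓ → GuardedScheme m
  isDeconstruction : ∀ i, (T i).IsDeconstruction φord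
  σ : Fin ℓ → PolyExpr (ordLang m) 𝓡
  σ_short : ∀ i, (σ i).IsShort
  σ_free : ∀ i, (σ i).free = ∅

open Classical in
/-- The valuation of a deconstruction tree: `∑ σ_i(G) * P(T_i(G))` over the enabled `i` at a node
marked by `G`, and `1` at the leaves. -/
def DTree.val {m : ℕ} {𝓡 : Type*} [CommSemiring 𝓡] (D : RecDef m 𝓡) :
    {G : CtxStr m} → DTree D.T G → 𝓡
  | _, .node G _ child => ∑ i, if hi : (D.T i).Enabled G then
      (D.σ i).eval G.toOrdStructure G.someAssignment *
        (if h : Nonempty ((D.T i).Universe G) then DTree.val D (child i hi h) else 1)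
      else 0

/-- SOL-feasibility of a recursive definition, for a class `𝒢` of graphs presented as structures by
`str`: every graph has an expansion in `VALORD`, every such expansion has a deconstruction tree, and
the valuation does not depend on the chosen expansion. -/
def RecDef.Feasible {m : ℕ} {𝓡 : Type*} [CommSemiring 𝓡] (D : RecDef m 𝓡)
    {𝒢 : Type*} (str : 𝒢 → BinStr) : Prop :=
  (∀ G : 𝒢, ∃ x O, (str G).expand x O ∈ VALORD D.φord) ∧
  (∀ (G : 𝒢) (x : Fin m → (str G).carrier) (O), (str G).expand x O ∈ VALORD D.φord →
    Nonempty (DTree D.T ((str G).expand x O))) ∧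
  (∀ (G : 𝒢) (x₁ x₂ : Fin m → (str G).carrier) (O₁ O₂),
    (str G).expand x₁ O₁ ∈ VALORD D.φord → (str G).expand x₂ O₂ ∈ VALORD D.φord →
    ∀ (Γ₁ : DTree D.T ((str G).expand x₁ O₁)) (Γ₂ : DTree D.T ((str G).expand x₂ O₂)),
      Γ₁.val D = Γ₂.val D)

/-- `P` has an SOL-feasible recursive definition on the class `𝒢`. -/
def HasFeasibleRecDef {𝒢 : Type*} (str : 𝒢 → BinStr) {𝓡 : Type*} [CommSemiring 𝓡]
    (P : 𝒢 → 𝓡) : Prop :=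
  ∃ (m : ℕ) (D : RecDef m 𝓡), D.Feasible str ∧
    ∀ (G : 𝒢) (x : Fin m → (str G).carrier) (O), (str G).expand x O ∈ VALORD D.φord →
      ∀ Γ : DTree D.T ((str G).expand x O), Γ.val D = P G

/-! ### Graphs and the Noble–Welsh polynomial -/

/-- Finite nonempty simple graphs. -/
structure FinGraph : Type 1 where
  V : Type
  [finV : Finite V]
  [neV : Nonempty V]
  graph : SimpleGraph V

attribute [instance] FinGraph.finV FinGraph.neV

/-- The universe is the set of vertices, the relation is adjacency. -/
def FinGraph.adjStr (G : FinGraph) : BinStr := ⟨G.V, G.graph.Adj⟩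

/-- Finite nonempty multigraphs (loops and parallel edges allowed): every edge has an unordered pair
of ends. -/
structure FinMultigraph : Type 1 where
  V : Type
  E : Type
  [finV : Finite V]
  [finE : Finite E]
  [neV : Nonempty V]
  ends : E → Sym2 V

attribute [instance] FinMultigraph.finV FinMultigraph.finE FinMultigraph.neV

/-- The universe consists of the vertices and the edges, the relation is incidence. -/
def FinMultigraph.incStr (G : FinMultigraph) : BinStr where
  carrier := G.V ⊕ G.E
  R := fun a b => ∃ v e, a = Sum.inl v ∧ b = Sum.inr e ∧ v ∈ G.ends e

/-- A simple graph as a multigraph. -/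
def FinGraph.toMultigraph (G : FinGraph) : FinMultigraph where
  V := G.V
  E := G.graph.edgeSet
  ends := Subtype.val

/-- The indeterminates `Y` and `X_i`. -/
inductive Indet : Type
  | Y : Indet
  | X (i : ℕ) : Indet

namespace FinMultigraph

/-- The adjacency of the spanning subgraph `(V, A)`; loops and multiplicities do not matter for its
connected components. -/
def spanning (G : FinMultigraph) (A : Set G.E) : SimpleGraph G.V :=
  SimpleGraph.fromEdgeSet (G.ends '' A)

/-- The number of connected components of `(V, A)`. -/
def k (G : FinMultigraph) (A : Set G.E) : ℕ := Nat.card (G.spanning A).ConnectedComponent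

/-- The rank `|V| - k(A)`. -/
def r (G : FinMultigraph) (A : Set G.E) : ℕ := Nat.card G.V - G.k A

/-- The number of connected components of `(V, A)` with exactly `i` vertices. -/
def s (G : FinMultigraph) (i : ℕ) (A : Set G.E) : ℕ :=
  {c : (G.spanning A).ConnectedComponent | c.supp.ncard = i}.ncard

/-- The Noble–Welsh polynomial, with coefficients in `K`. -/
def U (K : Type*) [CommSemiring K] (G : FinMultigraph) : MvPolynomial Indet K :=
  ∑ᶠ A : Set G.E, MvPolynomial.X Indet.Y ^ (A.ncard - G.r A) *
    ∏ i ∈ Finset.Icc 1 (Nat.card G.V), MvPolynomial.X (Indet.X i) ^ G.s i A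

end FinMultigraph

end SOL

end

noncomputable section

namespace SOL

open Filter

/-! ### Subsemirings that capture all values of an expression -/

section Values

variable {𝓡 : Type*} [CommSemiring 𝓡] {H : ℕ → Subsemiring 𝓡}

/-! An SOL-polynomial expression contains only finitely many elements of the polynomial ring, hence
only finitely many indeterminates, and its value in any structure arises from these, 0 and 1 by sums
and products. So for large `n` the indeterminate `X n` occurs in no value. The same holds for a
recursive definition, since the valuation of a deconstruction tree is built by sums and products
from values of the finitely many coefficients. But for a connected graph on `n` vertices the choice
`A = E` contributes a monomial that contains `X n`, and connected graphs of every order exist.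

To avoid supports of polynomials, "does not involve `X n`" is weakened to "has the same value at the
all-ones point after `X n` is set to 0", which defines the subsemiring `insensitive K n`. For the
Noble–Welsh polynomial both values count edge sets, and the counts differ because `A = E` is lost.
The argument is carried by `PolyExpr.eventually_eval_mem` and `DTree.val_mem` on one side and by
`U_notMem_insensitive` on the other. How graphs are presented as structures plays no role. -/

/-- If each element of `𝓡` lies in almost all members of a sequence of subsemirings, then so do all
values of a monomial expression at once, since the expression contains finitely many constants. -/
theorem MonoExpr.eventually_eval_mem {τ : FirstOrder.Language.{0, 0}}
    (hH : ∀ a, ∀ᶠ n in atTop, a ∈ H n) (t : MonoExpr τ 𝓡) :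
    ∀ᶠ n in atTop, ∀ (A : Type) (M : τ.Structure A) (z : Assignment A), t.eval M z ∈ H n := by
  induction t with
  | const a =>
    filter_upwards [hH a] with n hn A M z
    exact hn
  | tv φ =>
    refine Eventually.of_forall fun n A M z => ?_
    rw [MonoExpr.eval]
    split_ifs
    · exact one_mem _
    · exact zero_mem _
  | prod t ih =>
    filter_upwards [eventually_all.2 ih] with n hn A M z
    rw [MonoExpr.eval]
    exact prod_mem fun i _ => hn i A M z
  | bprod vs φ t ih =>
    filter_upwards [ih] with n hn A M z
    rw [MonoExpr.eval]
    -- `A` may be infinite here: a `finprod` with infinite support is 1 by default, which also lies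
    -- in `H n`.
    exact finprod_mem_induction (· ∈ H n) (one_mem _) (fun _ _ => mul_mem)
      fun z₁ _ => hn A M z₁

/-- A bound sum, short or long, only adds up values of its body, so the range of summation is
irrelevant and long sums give no additional power. -/
theorem PolyExpr.eventually_eval_mem {τ : FirstOrder.Language.{0, 0}}
    (hH : ∀ a, ∀ᶠ n in atTop, a ∈ H n) (t : PolyExpr τ 𝓡) :
    ∀ᶠ n in atTop, ∀ (A : Type) (M : τ.Structure A) (z : Assignment A), t.eval M z ∈ H n := by
  induction t with
  | mono t =>
    filter_upwards [t.eventually_eval_mem hH] with n hn A M z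
    exact hn A M z
  | sum t ih =>
    filter_upwards [eventually_all.2 ih] with n hn A M z
    rw [PolyExpr.eval]
    exact sum_mem fun i _ => hn i A M z
  | bsum vs φ t ih =>
    filter_upwards [ih] with n hn A M z
    rw [PolyExpr.eval]
    exact finsum_mem_induction (· ∈ H n) (zero_mem _) (fun _ _ => add_mem)
      fun z₁ _ => hn A M z₁
  | bsumRel Ws φ t ih =>
    filter_upwards [ih] with n hn A M z
    rw [PolyExpr.eval]
    exact finsum_mem_induction (· ∈ H n) (zero_mem _) (fun _ _ => add_mem)
      fun z₁ _ => hn A M z₁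

/-- The valuation of a deconstruction tree lies in every subsemiring that contains all values of the
coefficients. -/
theorem DTree.val_mem {m : ℕ} (D : RecDef m 𝓡) {S : Subsemiring 𝓡}
    (hS : ∀ (i : Fin D.ℓ) (A : Type) (M : (ordLang m).Structure A) (z : Assignment A),
      (D.σ i).eval M z ∈ S) {G : CtxStr m} (Γ : DTree D.T G) : Γ.val D ∈ S := by
  induction Γ with
  | node G _ child ih =>
    rw [DTree.val]
    refine sum_mem fun i _ => ?_
    split_ifs with hi h
    · exact mul_mem (hS i _ _ _) (ih i hi h)
    · exact mul_mem (hS i _ _ _) (one_mem _)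
    · exact zero_mem _

variable {𝒢 : Type*} {str : 𝒢 → BinStr} {P : 𝒢 → 𝓡}

theorem IsSOLPolynomial.eventually_mem (h : IsSOLPolynomial str P)
    (hH : ∀ a, ∀ᶠ n in atTop, a ∈ H n) : ∀ᶠ n in atTop, ∀ G, P G ∈ H n := by
  obtain ⟨S, hS⟩ := h
  filter_upwards [S.eventually_eval_mem hH] with n hn G
  rw [hS G ⟨fun _ => Classical.arbitrary _, fun _ _ => ∅⟩]
  exact hn _ _ _

/-- For each graph, one expansion with one deconstruction tree suffices, because the valuation of
that tree is already `P G`. -/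
theorem HasFeasibleRecDef.eventually_mem (h : HasFeasibleRecDef str P)
    (hH : ∀ a, ∀ᶠ n in atTop, a ∈ H n) : ∀ᶠ n in atTop, ∀ G, P G ∈ H n := by
  obtain ⟨m, D, ⟨hexp, htree, -⟩, hP⟩ := h
  filter_upwards [eventually_all.2 fun i => (D.σ i).eventually_eval_mem hH] with n hn G
  obtain ⟨x, O, hG⟩ := hexp G
  obtain ⟨Γ⟩ := htree G x O hG
  rw [← hP G x O hG Γ]
  exact Γ.val_mem D hn

end Values

/-! ### Insensitivity to an indeterminate -/

/-- The point with all coordinates `1`, except that `X n` has value `0`. -/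
def killX (K : Type*) [CommSemiring K] (n : ℕ) : Indet → K :=
  open Classical in fun i => if i = Indet.X n then 0 else 1

/-- The polynomials whose value at the all-ones point does not change if `X n` is set to `0`. -/
def insensitive (K : Type*) [CommSemiring K] (n : ℕ) : Subsemiring (MvPolynomial Indet K) :=
  (MvPolynomial.eval fun _ => (1 : K)).eqLocusS (MvPolynomial.eval (killX K n))

theorem mem_insensitive {K : Type*} [CommSemiring K] {n : ℕ} {p : MvPolynomial Indet K} :
    p ∈ insensitive K n ↔
      MvPolynomial.eval (fun _ => (1 : K)) p = MvPolynomial.eval (killX K n) p := Iff.rfl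

/-- A polynomial involves finitely many indeterminates; any `n` beyond all their indices works. -/
theorem eventually_mem_insensitive {K : Type*} [CommSemiring K] (p : MvPolynomial Indet K) :
    ∀ᶠ n in atTop, p ∈ insensitive K n := by
  induction p using MvPolynomial.induction_on with
  | C a => exact Eventually.of_forall fun n => by simp [mem_insensitive]
  | add p q hp hq =>
    filter_upwards [hp, hq] with n h₁ h₂
    exact add_mem h₁ h₂
  | mul_X p i hp =>
    have hi : ∀ᶠ n in atTop, i ≠ Indet.X n := by
      cases i with
      | Y => simp
      | X j =>
        filter_upwards [eventually_gt_atTop j] with n hn h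
        exact hn.ne (Indet.X.inj h)
    filter_upwards [hp, hi] with n h₁ h₂
    exact mul_mem h₁ (by simp [mem_insensitive, killX, h₂])

/-! ### The Noble–Welsh polynomial of a connected graph -/

namespace FinMultigraph

variable (K : Type*) [CommSemiring K] (G : FinMultigraph)

theorem eval_one_U : MvPolynomial.eval (fun _ => (1 : K)) (G.U K) = Nat.card (Set G.E) := by
  have := Fintype.ofFinite (Set G.E)
  simp [U, finsum_eq_sum_of_fintype]

/-- The monomial of `A` becomes `0 ^ s(|V|, A)`, which is 1 if the exponent is 0 and vanishes
otherwise. -/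
theorem eval_killX_U :
    MvPolynomial.eval (killX K (Nat.card G.V)) (G.U K) =
      Nat.card {A : Set G.E // G.s (Nat.card G.V) A = 0} := by
  classical
  have := Fintype.ofFinite (Set G.E)
  have hn : Nat.card G.V ∈ Finset.Icc 1 (Nat.card G.V) :=
    Finset.mem_Icc.2 ⟨Nat.card_pos, le_rfl⟩
  rw [U, finsum_eq_sum_of_fintype, map_sum,
    Nat.card_eq_fintype_card (α := {A : Set G.E // _}), Fintype.card_subtype, Finset.card_filter, Nat.cast_sum]
  refine Finset.sum_congr rfl fun A _ => ?_
  rw [map_mul, map_prod, Finset.prod_eq_single_of_mem _ hn]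
  · by_cases h : G.s (Nat.card G.V) A = 0 <;> simp [killX, h]
  · intro i _ hi
    simp [killX, hi]

variable {G}

/-- If `(V, E)` is connected, then `U` depends on the indeterminate `X_i` with `i = |V|`. -/
theorem U_notMem_insensitive [CharZero K] (hG : (G.spanning Set.univ).Connected) :
    G.U K ∉ insensitive K (Nat.card G.V) := by
  -- Characteristic zero turns the equality in `K` into an equality of two cardinalities.
  rw [mem_insensitive, eval_one_U, eval_killX_U, Nat.cast_inj]
  -- The full edge set is the witness for strictness: its only component has `|V|` vertices, so it
  -- is missing from the second count.
  refine (Finite.card_subtype_lt (x := Set.univ) ?_).ne'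
  obtain ⟨v⟩ := G.neV
  rw [s, Set.ncard_eq_zero, ← ne_eq, ← Set.nonempty_iff_ne_empty]
  refine ⟨(G.spanning Set.univ).connectedComponentMk v, ?_⟩
  have : ((G.spanning Set.univ).connectedComponentMk v).supp = Set.univ :=
    Set.eq_univ_of_forall fun w => SimpleGraph.ConnectedComponent.sound (hG.preconnected w v)
  rw [Set.mem_ofPred_eq, this, Set.ncard_univ]

end FinMultigraph

/-! ### Complete graphs as counterexamples -/

/-- The complete graph on `n + 1` vertices. -/
def FinGraph.complete (n : ℕ) : FinGraph := ⟨Fin (n + 1), ⊤⟩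

theorem FinGraph.spanning_univ_toMultigraph (G : FinGraph) :
    G.toMultigraph.spanning Set.univ = G.graph := by
  have : Set.range (Subtype.val : G.graph.edgeSet → Sym2 G.V) = G.graph.edgeSet :=
    Subtype.range_val
  rw [FinMultigraph.spanning, Set.image_univ]
  exact (congrArg SimpleGraph.fromEdgeSet this).trans G.graph.fromEdgeSet_edgeSet

theorem FinGraph.complete_U_notMem_insensitive (K : Type*) [CommSemiring K] [CharZero K] (n : ℕ) :
    (complete n).toMultigraph.U K ∉ insensitive K (n + 1) := by
  have hc : ((complete n).toMultigraph.spanning Set.univ).Connected := by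
    rw [spanning_univ_toMultigraph]
    exact SimpleGraph.connected_top (V := Fin (n + 1))
  have hcard : Nat.card (complete n).toMultigraph.V = n + 1 := Nat.card_fin (n + 1)
  simpa only [hcard] using FinMultigraph.U_notMem_insensitive K hc

theorem not_eventually_simple (K : Type*) [CommSemiring K] [CharZero K] :
    ¬ ∀ᶠ n in atTop, ∀ G : FinGraph, G.toMultigraph.U K ∈ insensitive K n := by
  intro h
  -- The shift by one matches `complete n`, which has `n + 1` vertices so as to be non-empty for
  -- every `n`.
  obtain ⟨n, hn⟩ := ((tendsto_add_atTop_nat 1).eventually h).exists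
  exact FinGraph.complete_U_notMem_insensitive K n (hn _)

theorem not_eventually_multigraph (K : Type*) [CommSemiring K] [CharZero K] :
    ¬ ∀ᶠ n in atTop, ∀ G : FinMultigraph, G.U K ∈ insensitive K n := fun h =>
  not_eventually_simple K (h.mono fun _ hn G => hn G.toMultigraph)

end SOL

end

theorem mainTheorem2 (K : Type*) [CommSemiring K] [CharZero K] :
    (¬ SOL.IsSOLPolynomial SOL.FinGraph.adjStr (fun G => G.toMultigraph.U K) ∧
      ¬ SOL.IsSOLPolynomial SOL.FinMultigraph.incStr (fun G => G.U K)) ∧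
    (¬ SOL.HasFeasibleRecDef SOL.FinGraph.adjStr (fun G => G.toMultigraph.U K) ∧
      ¬ SOL.HasFeasibleRecDef SOL.FinMultigraph.incStr (fun G => G.U K)) :=
  ⟨⟨fun h => SOL.not_eventually_simple K (h.eventually_mem SOL.eventually_mem_insensitive),
    fun h => SOL.not_eventually_multigraph K (h.eventually_mem SOL.eventually_mem_insensitive)⟩,
    fun h => SOL.not_eventually_simple K (h.eventually_mem SOL.eventually_mem_insensitive),
    fun h => SOL.not_eventually_multigraph K (h.eventually_mem SOL.eventually_mem_insensitive)⟩
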